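/- A metric linear space is a real linear space $X$ endowed with a translation-invariant metric in whose topology the scalar multiplication $\mathbb R\times X\to X$ is continuous; it is complete if this metric is complete. A Borel measure $\mu$ on $X$ is Radon if for every $\varepsilon>0$ there is a compact $K\subset X$ with $\mu(X\setminus K)<\varepsilon$. A set $A\subset X$ is universally measurable if it is measurable with respect to (the completion of) every $\sigma$-additive Radon Borel probability measure on $X$. A universally measurable set $A\subset X$ is Haar-null if there is a $\sigma$-additive Radon Borel probability measure $\mu$ on $X$ with $\mu(x+A)=0$ for all $x\in X$. Theorem. Let $X$ be a complete metric linear space, let $G\subset X$ be a non-empty open convex set, and let $f:G\to\mathbb R$ be mid-point convex, that is, $f(\tfrac12x+\tfrac12y)\le\tfrac12f(x)+\tfrac12f(y)$ for all $x,y\in G$. Then $f$ is continuous if and only if $f$ is upper bounded on some universally measurable set $B\subset G$ which is not Haar-null in $X$. -/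

import Mathlib

open MeasureTheory Set

/-- A Borel measure is Radon (tight): it is concentrated on a compact set up to any `ε > 0`. -/
def IsRadonMeasure {X : Type*} [TopologicalSpace X] [MeasurableSpace X] (μ : Measure X) : Prop :=
  ∀ ε : ENNReal, 0 < ε → ∃ K : Set X, IsCompact K ∧ μ Kᶜ < ε

/-- `A` is universally measurable: it is measurable with respect to (the completion of) every
Radon Borel probability measure. -/
def IsUniversallyMeasurable {X : Type*} [TopologicalSpace X] [MeasurableSpace X]
    (A : Set X) : Prop :=
  ∀ μ : Measure X, IsProbabilityMeasure μ → IsRadonMeasure μ → NullMeasurableSet A μ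

/-- `A` is Haar-null: it is universally measurable, and some Radon Borel probability measure
vanishes on all translates of `A`. -/
def IsHaarNull {X : Type*} [AddCommGroup X] [TopologicalSpace X] [MeasurableSpace X]
    (A : Set X) : Prop :=
  IsUniversallyMeasurable A ∧
    ∃ μ : Measure X, IsProbabilityMeasure μ ∧ IsRadonMeasure μ ∧
      ∀ x : X, μ ((fun a => x + a) '' A) = 0

/-- `f` is mid-point convex (Jensen convex) on the set `G`, which is assumed convex in uses. -/
def IsMidpointConvexOn {X : Type*} [AddCommGroup X] [Module ℝ X]
    (G : Set X) (f : X → ℝ) : Prop :=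
  ∀ x ∈ G, ∀ y ∈ G,
    f ((1 / 2 : ℝ) • x + (1 / 2 : ℝ) • y) ≤ (1 / 2 : ℝ) * f x + (1 / 2 : ℝ) * f y

open Filter Topology ENNReal

/-! If `f` were unbounded above near `p`, there would be `z n` with norm at most `2⁻ⁿ` and `f (p +
2⁻ⁿ z n) > n`. The law of the random subsum of `∑ z n` is Radon, so it charges some translate of
`B`; invariance under flipping one coin then gives a single `x` with `x + z n ∈ B` for infinitely
many `n`. Contracting `x + z n` and a reflection of `x` towards `p` exhibits `p + 2⁻ⁿ z n` as a
midpoint of points where `f` is bounded independently of `n`, a contradiction. Local upper bounds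
give continuity by reflection. -/

/-! ### Coin tossing and single flips -/

/-- The distribution of a sequence of independent fair coin tosses. -/
noncomputable def coinMeasure : Measure (ℕ → Bool) :=
  Measure.infinitePi fun _ => (2⁻¹ : ℝ≥0∞) • (Measure.dirac true + Measure.dirac false)

instance isProbabilityMeasure_half_dirac_add_dirac :
    IsProbabilityMeasure ((2⁻¹ : ℝ≥0∞) • (Measure.dirac true + Measure.dirac false)) :=
  ⟨by simp [ENNReal.inv_two_add_inv_two]⟩

instance isProbabilityMeasure_coinMeasure : IsProbabilityMeasure coinMeasure := by
  unfold coinMeasure; infer_instance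

/-- Change the `n`-th term of a binary sequence. -/
def flipAt (n : ℕ) (e : ℕ → Bool) : ℕ → Bool := fun i => if i = n then !(e i) else e i

theorem flipAt_same (n : ℕ) (e : ℕ → Bool) : flipAt n e n = !(e n) := by simp [flipAt]

theorem flipAt_of_ne {n i : ℕ} (h : i ≠ n) (e : ℕ → Bool) : flipAt n e i = e i := by
  simp [flipAt, h]

theorem measurePreserving_flipAt (n : ℕ) :
    MeasurePreserving (flipAt n) coinMeasure coinMeasure := by
  have hm : ∀ i : ℕ, Measurable (fun b : Bool => if i = n then !b else b) :=
    fun i => measurable_of_finite _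
  refine ⟨measurable_pi_lambda _ fun i => (hm i).comp (measurable_pi_apply i), ?_⟩
  have h := Measure.infinitePi_map_pi
    (μ := fun _ : ℕ => (2⁻¹ : ℝ≥0∞) • (Measure.dirac true + Measure.dirac false)) hm
  unfold coinMeasure
  refine Eq.trans h ?_
  congr 1
  funext i
  rw [Measure.map_smul, Measure.map_add _ _ (hm i), Measure.map_dirac' (hm i),
    Measure.map_dirac' (hm i)]
  by_cases hi : i = n
  · simp [hi, add_comm]
  · simp [hi]

theorem measurableSet_coord (n : ℕ) (b : Bool) : MeasurableSet {e : ℕ → Bool | e n = b} :=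
  measurableSet_eq_fun (measurable_pi_apply n) measurable_const

/-- Flipping different coins `u (k + j)` yields infinitely many disjoint sets of the same measure in
a probability space. -/
theorem coinMeasure_forall_ge_eq_false {u : ℕ → ℕ} (hu : StrictMono u) (k : ℕ) :
    coinMeasure {e | ∀ j ≥ k, e (u j) = false} = 0 := by
  set S : Set (ℕ → Bool) := {e | ∀ j ≥ k, e (u j) = false} with hS
  have hSm : MeasurableSet S := by
    have : S = ⋂ j, ⋂ (_ : j ≥ k), {e | e (u j) = false} := by ext; simp [hS]
    rw [this]
    exact MeasurableSet.iInter fun j => MeasurableSet.iInter fun _ => measurableSet_coord _ _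
  have hmeas : ∀ j, coinMeasure (flipAt (u (k + j)) ⁻¹' S) = coinMeasure S := fun j =>
    (measurePreserving_flipAt _).measure_preimage hSm.nullMeasurableSet
  have hdisj : Pairwise (Function.onFun Disjoint fun j => flipAt (u (k + j)) ⁻¹' S) := by
    intro i j hij
    refine Set.disjoint_left.2 fun e hi hj => ?_
    have h1 : flipAt (u (k + i)) e (u (k + i)) = false := hi (k + i) (Nat.le_add_right _ _)
    have h2 : flipAt (u (k + j)) e (u (k + i)) = false := hj (k + i) (Nat.le_add_right _ _)
    have hne : u (k + i) ≠ u (k + j) := fun h => hij (by simpa using hu.injective h)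
    rw [flipAt_same] at h1
    rw [flipAt_of_ne hne] at h2
    simp [h2] at h1
  have hU := measure_iUnion (μ := coinMeasure) hdisj
    fun j => (measurePreserving_flipAt _).measurable hSm
  simp_rw [hmeas] at hU
  by_contra h0
  rw [ENNReal.tsum_const_eq_top_of_ne_zero h0] at hU
  exact measure_ne_top _ _ hU

/-- Otherwise `coinMeasure (D n)` tends to `0`, and Borel–Cantelli along a sparse subsequence makes
almost every point of `C` eventually `false` there, a null event. -/
theorem exists_frequently_flipAt_mem {C : Set (ℕ → Bool)} (hC : NullMeasurableSet C coinMeasure)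
    (h0 : coinMeasure C ≠ 0) :
    ∃ e, ∃ᶠ n in atTop, e n = false ∧ flipAt n e ∈ C := by
  by_contra! hcon
  set E : ℕ → Set (ℕ → Bool) := fun n => {e | e n = false ∧ flipAt n e ∈ C} with hE
  set D : ℕ → Set (ℕ → Bool) := fun n => {e | e n = true} ∩ C with hD
  have hDm : ∀ n, NullMeasurableSet (D n) coinMeasure := fun n =>
    (measurableSet_coord n true).nullMeasurableSet.inter hC
  have hED : ∀ n, E n = flipAt n ⁻¹' D n := by
    intro n; ext e; simp [hE, hD, flipAt_same]
  have hEm : ∀ n, NullMeasurableSet (E n) coinMeasure := fun n => by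
    rw [hED]; exact (hDm n).preimage (measurePreserving_flipAt n).quasiMeasurePreserving
  have hmeas : ∀ n, coinMeasure (E n) = coinMeasure (D n) := fun n => by
    rw [hED]; exact (measurePreserving_flipAt n).measure_preimage (hDm n)
  -- The limsup of the `E n` is empty by `hcon`, so continuity from above applies to their tails.
  have hempty : ⋂ n, ⋃ m, ⋃ (_ : n ≤ m), E m = ∅ := by
    refine Set.eq_empty_of_forall_notMem fun e he => ?_
    obtain ⟨N, hN⟩ := eventually_atTop.1 (hcon e)
    obtain ⟨m, hm, hme⟩ : ∃ m, N ≤ m ∧ e ∈ E m := by simpa using Set.mem_iInter.1 he N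
    exact hN m hm hme.1 hme.2
  have hlim : Tendsto (fun n => coinMeasure (D n)) atTop (𝓝 0) := by
    have h := tendsto_measure_iInter_atTop (μ := coinMeasure)
      (s := fun n => ⋃ m, ⋃ (_ : n ≤ m), E m)
      (fun n => NullMeasurableSet.iUnion fun m => NullMeasurableSet.iUnion fun _ => hEm m)
      (fun a b hab => Set.iUnion_mono fun m =>
        Set.iUnion_mono' fun h => ⟨hab.trans h, subset_rfl⟩)
      ⟨0, measure_ne_top _ _⟩
    rw [hempty, measure_empty] at h
    refine tendsto_of_tendsto_of_tendsto_of_le_of_le tendsto_const_nhds h (fun _ => zero_le)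
      fun n => ?_
    rw [← hmeas]
    exact measure_mono (Set.subset_biUnion_of_mem (u := E) (Set.mem_ofPred_eq ▸ le_refl n))
  obtain ⟨u, hu, hlt⟩ := extraction_forall_of_eventually
    (P := fun n k => coinMeasure (D k) < (2⁻¹ : ℝ≥0∞) ^ n)
    fun n => hlim.eventually (gt_mem_nhds (ENNReal.pow_pos (by simp) n))
  have hsum : ∑' n, coinMeasure (D (u n)) ≠ ∞ := by
    refine ne_top_of_le_ne_top ?_ (ENNReal.tsum_le_tsum fun n => (hlt n).le)
    simp [ENNReal.tsum_geometric]
  have hae := ae_eventually_notMem hsum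
  have hnull : ∀ᵐ e ∂coinMeasure, ∀ k, ¬ ∀ j ≥ k, e (u j) = false :=
    ae_all_iff.2 fun k => by
      have := coinMeasure_forall_ge_eq_false hu k
      rw [ae_iff]; simpa using this
  refine h0 (measure_eq_zero_iff_ae_notMem.2 ?_)
  filter_upwards [hae, hnull] with e h1 h2 heC
  obtain ⟨k, hk⟩ := eventually_atTop.1 h1
  refine h2 k fun j hj => ?_
  by_contra hne
  exact hk j hj ⟨by simpa using hne, heC⟩

/-! ### Haar-null sets -/

theorem not_isHaarNull_of_isOpen {X : Type*} [NormedAddCommGroup X] [MeasurableSpace X]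
    {U : Set X} (hU : IsOpen U) (hne : U.Nonempty) :
    ¬ IsHaarNull U := by
  rintro ⟨-, μ, hμ, hR, h0⟩
  obtain ⟨u, hu⟩ := hne
  obtain ⟨K, hK, hlt⟩ := hR 1 one_pos
  -- Every point of `K` has a null neighbourhood, a translate of `U`.
  have hKz : μ K = 0 := hK.measure_zero_of_nhdsWithin fun x _ =>
    ⟨(fun a => (x - u) + a) '' U, mem_nhdsWithin_of_mem_nhds
      ((isOpenMap_add_left (x - u) U hU).mem_nhds ⟨u, hu, by simp⟩), h0 _⟩
  have huniv : μ Set.univ ≤ μ K + μ Kᶜ := by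
    rw [← Set.union_compl_self K]; exact measure_union_le _ _
  rw [hKz, zero_add, measure_univ] at huniv
  exact absurd hlt huniv.not_gt

section HaarNull

variable {X : Type*} [NormedAddCommGroup X] [MeasurableSpace X] [BorelSpace X]

theorem IsRadonMeasure.map {Y : Type*} [TopologicalSpace Y] [T2Space Y] [MeasurableSpace Y]
    [BorelSpace Y] {Z : Type*} [TopologicalSpace Z] [MeasurableSpace Z] [BorelSpace Z]
    {μ : Measure Z} (hμ : IsRadonMeasure μ) {g : Z → Y} (hg : Continuous g) :
    IsRadonMeasure (μ.map g) := by
  intro ε hε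
  obtain ⟨K, hK, hlt⟩ := hμ ε hε
  refine ⟨g '' K, hK.image hg, ?_⟩
  rw [Measure.map_apply hg.measurable (hK.image hg).measurableSet.compl]
  refine (measure_mono ?_).trans_lt hlt
  exact fun z hz hzK => hz (Set.mem_image_of_mem g hzK)

theorem isRadonMeasure_of_compactSpace {Z : Type*} [TopologicalSpace Z] [CompactSpace Z]
    [MeasurableSpace Z] (μ : Measure Z) : IsRadonMeasure μ :=
  fun ε hε => ⟨Set.univ, isCompact_univ, by simpa using hε⟩

theorem IsUniversallyMeasurable.add_image {A : Set X} (hA : IsUniversallyMeasurable A) (x : X) :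
    IsUniversallyMeasurable ((fun a => x + a) '' A) := by
  intro μ hμ hR
  have hc : Continuous fun a : X => -x + a := by fun_prop
  have := hA (μ.map fun a => -x + a) (Measure.isProbabilityMeasure_map hc.measurable.aemeasurable)
    (hR.map hc)
  have h := this.preimage (hc.measurable.measurePreserving μ).quasiMeasurePreserving
  rwa [Set.image_add_left]

/-- The test measure is the law of `∑ e n • z n` for fair coins `e`; turning coin `n` on adds
exactly `z n` to the sum. -/
theorem exists_frequently_add_mem_of_not_isHaarNull [CompleteSpace X] {A : Set X}
    (hA : IsUniversallyMeasurable A) (hnull : ¬ IsHaarNull A) {z : ℕ → X}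
    (hz : ∀ n, ‖z n‖ ≤ (1 / 2 : ℝ) ^ n) :
    ∃ x, ∃ᶠ n in atTop, x + z n ∈ A := by
  have hbound : ∀ n (e : ℕ → Bool), ‖if e n then z n else 0‖ ≤ (1 / 2 : ℝ) ^ n := by
    intro n e
    split_ifs
    · exact hz n
    · simp
  have hsum : Summable fun n : ℕ => (1 / 2 : ℝ) ^ n := summable_geometric_two
  set h : (ℕ → Bool) → X := fun e => ∑' n, if e n then z n else 0 with hh
  have hcont : Continuous h := continuous_tsum
    (fun n => (continuous_of_discreteTopology (f := fun b : Bool => if b then z n else 0)).comp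
      (continuous_apply n)) hsum hbound
  have hflip : ∀ n e, e n = false → h (flipAt n e) = h e + z n := by
    intro n e hen
    have hs : ∀ e : ℕ → Bool, Summable fun n => if e n then z n else 0 := fun e =>
      hsum.of_norm_bounded fun n => hbound n e
    rw [← sub_eq_iff_eq_add', hh]
    dsimp only
    rw [← (hs _).tsum_sub (hs _), tsum_eq_single n]
    · simp [flipAt_same, hen]
    · intro i hi
      simp [flipAt_of_ne hi]
  have hR : IsRadonMeasure (coinMeasure.map h) :=
    (isRadonMeasure_of_compactSpace coinMeasure).map hcont
  have hP : IsProbabilityMeasure (coinMeasure.map h) :=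
    Measure.isProbabilityMeasure_map hcont.measurable.aemeasurable
  obtain ⟨x, hx⟩ : ∃ x : X, coinMeasure.map h ((fun a => x + a) '' A) ≠ 0 := by
    by_contra! hcon
    exact hnull ⟨hA, _, hP, hR, hcon⟩
  have hm := hA.add_image x _ hP hR
  rw [Measure.map_apply₀ hcont.measurable.aemeasurable hm] at hx
  obtain ⟨e, he⟩ := exists_frequently_flipAt_mem
    (hm.preimage (hcont.measurable.measurePreserving _).quasiMeasurePreserving) hx
  refine ⟨-x + h e, he.mono fun n hn => ?_⟩
  have := hn.2
  rwa [Set.mem_preimage, hflip n e hn.1, Set.image_add_left, Set.mem_preimage, ← add_assoc] at this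

end HaarNull

/-! ### Dyadic contraction towards a point -/

section MidpointConvex

variable {X : Type*} [AddCommGroup X] [Module ℝ X] {G : Set X} {f : X → ℝ}

theorem Convex.midpoint_combo_mem (hG : Convex ℝ G) {x y : X} (hx : x ∈ G) (hy : y ∈ G) :
    (1 / 2 : ℝ) • x + (1 / 2 : ℝ) • y ∈ G :=
  hG hx hy (by norm_num) (by norm_num) (by norm_num)

theorem midpoint_combo_pow_succ (p v : X) (k : ℕ) :
    p + (1 / 2 : ℝ) ^ (k + 1) • v =
      (1 / 2 : ℝ) • (p + (1 / 2 : ℝ) ^ k • v) + (1 / 2 : ℝ) • p := by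
  rw [pow_succ]; module

theorem Convex.add_pow_smul_mem (hG : Convex ℝ G) {p v : X} (hp : p ∈ G) (hv : p + v ∈ G)
    (k : ℕ) : p + (1 / 2 : ℝ) ^ k • v ∈ G := by
  induction k with
  | zero => simpa using hv
  | succ k ih => rw [midpoint_combo_pow_succ]; exact hG.midpoint_combo_mem ih hp

theorem IsMidpointConvexOn.add_pow_smul_le (hf : IsMidpointConvexOn G f) (hG : Convex ℝ G)
    {p v : X} (hp : p ∈ G) (hv : p + v ∈ G) (k : ℕ) :
    f (p + (1 / 2 : ℝ) ^ k • v) - f p ≤ (1 / 2 : ℝ) ^ k * (f (p + v) - f p) := by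
  induction k with
  | zero => simp
  | succ k ih =>
    rw [midpoint_combo_pow_succ, pow_succ]
    have := hf _ (hG.add_pow_smul_mem hp hv k) _ hp
    linarith

theorem IsMidpointConvexOn.add_pow_smul_le_max (hf : IsMidpointConvexOn G f) (hG : Convex ℝ G)
    {p v : X} (hp : p ∈ G) (hv : p + v ∈ G) (k : ℕ) :
    f (p + (1 / 2 : ℝ) ^ k • v) ≤ max (f (p + v)) (f p) := by
  have h := hf.add_pow_smul_le hG hp hv k
  have h1 : (1 / 2 : ℝ) ^ k ≤ 1 := pow_le_one₀ (by norm_num) (by norm_num)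
  have h0 : (0 : ℝ) ≤ (1 / 2 : ℝ) ^ k := by positivity
  rcases le_total (f (p + v)) (f p) with hle | hle
  · rw [max_eq_right hle]
    nlinarith
  · rw [max_eq_left hle]
    nlinarith

end MidpointConvex

/-! ### Local upper bounds and continuity -/

section Continuity

variable {X : Type*} [NormedAddCommGroup X] [Module ℝ X] [ContinuousSMul ℝ X]
  {G : Set X} {f : X → ℝ}

theorem tendsto_half_pow_smul (v : X) :
    Tendsto (fun k : ℕ => (1 / 2 : ℝ) ^ k • v) atTop (𝓝 0) := by
  have : Tendsto (fun k : ℕ => (1 / 2 : ℝ) ^ k) atTop (𝓝 0) :=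
    tendsto_pow_atTop_nhds_zero_of_lt_one (by norm_num) (by norm_num)
  simpa using this.smul_const v

/-- A midpoint convex function which is bounded above near a point is continuous there. -/
theorem IsMidpointConvexOn.continuousAt (hf : IsMidpointConvexOn G f) (hG : Convex ℝ G)
    (hGo : IsOpen G) {p : X} (hp : p ∈ G) {M : ℝ} (hM : ∀ᶠ x in 𝓝 p, f x ≤ M) :
    ContinuousAt f p := by
  have hadd : Tendsto (fun v : X => p + v) (𝓝 0) (𝓝 p) := by
    simpa using (continuous_const_add p).tendsto (0 : X)
  have hU : ∀ᶠ v in 𝓝 (0 : X), p + v ∈ G ∧ f (p + v) ≤ M :=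
    hadd.eventually (Filter.Eventually.and (hGo.mem_nhds hp) hM)
  have hneg : Tendsto (fun v : X => -v) (𝓝 0) (𝓝 0) := by
    simpa using (continuous_neg (G := X)).tendsto 0
  have hpM : f p ≤ M := by simpa using hU.self_of_nhds.2
  rw [Metric.continuousAt_iff']
  intro ε hε
  obtain ⟨k, hk⟩ : ∃ k : ℕ, (1 / 2 : ℝ) ^ k * (M - f p) < ε := by
    have : Tendsto (fun k : ℕ => (1 / 2 : ℝ) ^ k * (M - f p)) atTop (𝓝 0) := by
      simpa using (tendsto_pow_atTop_nhds_zero_of_lt_one (r := (1 / 2 : ℝ)) (by norm_num)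
        (by norm_num)).mul_const (M - f p)
    exact (this.eventually (gt_mem_nhds hε)).exists
  have hc : (2 : ℝ) ^ k ≠ 0 := by positivity
  have hscale : Tendsto (fun x : X => (2 : ℝ) ^ k • (x - p)) (𝓝 p) (𝓝 0) := by
    have : Continuous fun x : X => (2 : ℝ) ^ k • (x - p) := by fun_prop
    simpa using this.tendsto p
  have hupper : ∀ v : X, (p + v ∈ G ∧ f (p + v) ≤ M) →
      f (p + (1 / 2 : ℝ) ^ k • v) - f p < ε := by
    intro v hv
    refine (hf.add_pow_smul_le hG hp hv.1 k).trans_lt (lt_of_le_of_lt ?_ hk)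
    gcongr
    exact hv.2
  filter_upwards [hscale.eventually hU, (hneg.comp hscale).eventually hU] with x h1 h2
  have e1 : (1 / 2 : ℝ) ^ k • (2 : ℝ) ^ k • (x - p) = x - p := by
    rw [smul_smul, ← mul_pow]; norm_num
  have u1 := hupper _ h1
  have u2 := hupper _ h2
  have m1 := hG.add_pow_smul_mem hp h1.1 k
  have m2 := hG.add_pow_smul_mem hp h2.1 k
  simp only [Function.comp_apply, smul_neg, e1] at u1 u2 m1 m2
  -- As `p` is the midpoint of `x` and its reflection, the upper bound at the reflection bounds `f
  -- x` below.
  have hmid := hf _ m1 _ m2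
  have e2 : (1 / 2 : ℝ) • (p + (x - p)) + (1 / 2 : ℝ) • (p + -(x - p)) = p := by module
  rw [e2] at hmid
  rw [add_sub_cancel] at u1 hmid
  rw [Real.dist_eq, abs_lt]
  constructor <;> linarith

/-- A midpoint convex function bounded above on a universally measurable set that is not Haar-null
is locally bounded above. -/
theorem IsMidpointConvexOn.eventually_le_of_not_isHaarNull [CompleteSpace X] [MeasurableSpace X]
    [BorelSpace X] (hf : IsMidpointConvexOn G f) (hG : Convex ℝ G) (hGo : IsOpen G)
    {B : Set X} (hBG : B ⊆ G) (hB : IsUniversallyMeasurable B) (hnull : ¬ IsHaarNull B)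
    {M : ℝ} (hM : ∀ b ∈ B, f b ≤ M) {p : X} (hp : p ∈ G) :
    ∃ L : ℝ, ∀ᶠ x in 𝓝 p, f x ≤ L := by
  by_contra! hcon
  have hex : ∀ n : ℕ, ∃ z : X, ‖z‖ ≤ (1 / 2 : ℝ) ^ n ∧ (n : ℝ) < f (p + (1 / 2 : ℝ) ^ n • z) := by
    intro n
    have hscale : Tendsto (fun x : X => (2 : ℝ) ^ n • (x - p)) (𝓝 p) (𝓝 0) := by
      have : Continuous fun x : X => (2 : ℝ) ^ n • (x - p) := by fun_prop
      simpa using this.tendsto p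
    have hball := hscale.eventually
      (Metric.closedBall_mem_nhds (0 : X) (ε := (1 / 2 : ℝ) ^ n) (by positivity))
    obtain ⟨x, hx, hxb⟩ := ((hcon n).and_eventually hball).exists
    refine ⟨_, mem_closedBall_zero_iff.1 hxb, ?_⟩
    have e1 : (1 / 2 : ℝ) ^ n • (2 : ℝ) ^ n • (x - p) = x - p := by
      rw [smul_smul, ← mul_pow]; norm_num
    rw [e1, add_sub_cancel]
    exact lt_of_not_ge (by simpa using hx)
  choose z hz hfz using hex
  obtain ⟨x, hx⟩ := exists_frequently_add_mem_of_not_isHaarNull hB hnull hz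
  -- The reflection `p + w` of `x` may lie outside `G`, so it is first contracted by a fixed `2⁻ᵐ`,
  -- chosen before `n`.
  set w : X := p - x with hw
  have hwG : ∀ᶠ m : ℕ in atTop, p + (1 / 2 : ℝ) ^ m • w ∈ G := by
    have : Tendsto (fun m : ℕ => p + (1 / 2 : ℝ) ^ m • w) atTop (𝓝 p) := by
      simpa using (tendsto_half_pow_smul w).const_add p
    exact this.eventually (hGo.mem_nhds hp)
  obtain ⟨m, hm⟩ := hwG.exists
  set L : ℝ := max (max M (f (p + (1 / 2 : ℝ) ^ m • w))) (f p) with hL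
  obtain ⟨N, hN⟩ := exists_nat_ge L
  obtain ⟨n, ⟨hnB, hnN⟩, hnm⟩ :=
    ((hx.and_eventually (eventually_ge_atTop N)).and_eventually
      (eventually_ge_atTop (m + 1))).exists
  obtain ⟨j, rfl⟩ : ∃ j, n = m + j + 1 := ⟨n - (m + 1), by omega⟩
  set b : X := x + z (m + j + 1) with hb
  have hbp : p + (b - p) ∈ G := by simpa using hBG hnB
  have h1 := hf.add_pow_smul_le_max hG hp hbp (m + j)
  have h2 := hf.add_pow_smul_le_max hG hp hm j
  have hmid := hf _ (hG.add_pow_smul_mem hp hbp (m + j)) _ (hG.add_pow_smul_mem hp hm j)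
  -- Since `b - p + w = z n`, the unknown `x` cancels; the midpoint supplies the last factor `1/2`,
  -- hence `n = m + j + 1`.
  have e : (1 / 2 : ℝ) • (p + (1 / 2 : ℝ) ^ (m + j) • (b - p)) +
      (1 / 2 : ℝ) • (p + (1 / 2 : ℝ) ^ j • (1 / 2 : ℝ) ^ m • w) =
      p + (1 / 2 : ℝ) ^ (m + j + 1) • z (m + j + 1) := by
    rw [hb, hw, pow_succ, pow_add]; module
  rw [e] at hmid
  have l1 : f (p + (1 / 2 : ℝ) ^ (m + j) • (b - p)) ≤ L := by
    refine h1.trans (max_le_max_right _ ?_)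
    rw [add_sub_cancel]
    exact (hM _ hnB).trans (le_max_left _ _)
  have l2 : f (p + (1 / 2 : ℝ) ^ j • (1 / 2 : ℝ) ^ m • w) ≤ L :=
    h2.trans (max_le_max_right _ (le_max_right _ _))
  have hlt := hfz (m + j + 1)
  have hNn : (N : ℝ) ≤ ((m + j + 1 : ℕ) : ℝ) := by exact_mod_cast hnN
  linarith

end Continuity

/-- A complete metric linear space is an abelian group with a complete invariant metric
(equivalently, a prenorm, i.e. `NormedAddCommGroup`; no homogeneity of the prenorm is assumed)
and a jointly continuous multiplication by real scalars. -/
theorem mainTheorem3 {X : Type*} [NormedAddCommGroup X] [CompleteSpace X]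
    [Module ℝ X] [ContinuousSMul ℝ X] [MeasurableSpace X] [BorelSpace X]
    (G : Set X) (hGne : G.Nonempty) (hGo : IsOpen G) (hGc : Convex ℝ G)
    (f : X → ℝ) (hf : IsMidpointConvexOn G f) :
    ContinuousOn f G ↔
      ∃ B : Set X, B ⊆ G ∧ IsUniversallyMeasurable B ∧ ¬ IsHaarNull B ∧ BddAbove (f '' B) := by
  constructor
  · intro hcont
    obtain ⟨p, hp⟩ := hGne
    have hopen : IsOpen (G ∩ f ⁻¹' Set.Iio (f p + 1)) := hcont.isOpen_inter_preimage hGo isOpen_Iio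
    refine ⟨G ∩ f ⁻¹' Set.Iio (f p + 1), Set.inter_subset_left,
      fun μ _ _ => hopen.measurableSet.nullMeasurableSet,
      not_isHaarNull_of_isOpen hopen ⟨p, hp, by simp⟩, f p + 1, ?_⟩
    rintro _ ⟨x, hx, rfl⟩
    exact (Set.mem_Iio.1 hx.2).le
  · rintro ⟨B, hBG, hB, hnull, M, hM⟩ p hp
    obtain ⟨L, hL⟩ := hf.eventually_le_of_not_isHaarNull hGc hGo hBG hB hnull
      (fun b hb => hM ⟨b, hb, rfl⟩) hp
    exact (hf.continuousAt hGc hGo hp hL).continuousWithinAt
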